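/- Let $\nu$ be Lebesgue measure on the circle $\mathbb{R}/\mathbb{Z}$ (so $\nu(\mathbb{R}/\mathbb{Z})=1$), and let $f=\chi_{[0,1/2)}-\chi_{[1/2,1)}:\mathbb{R}/\mathbb{Z}\to\mathbb{Z}$. For irrational $\alpha\in(0,1)$, the infinite staircase in direction $\alpha$ is the skew product $T_\alpha(x,m)=(x+\alpha,\,m+f(x))$ on $\mathbb{R}/\mathbb{Z}\times\mathbb{Z}$, equipped with the product of $\nu$ and counting measure; its Lyapunov exponent is $$\Lambda(\alpha)=\limsup_{n\to\infty}\frac{\log\left(\operatorname{ess\,sup}_{x\in\mathbb{R}/\mathbb{Z}}\left|\sum_{i=0}^{n-1}f(x+i\alpha)\right|\right)}{\log n}.$$ For each $\lambda\in(0,1/2)$ there is an uncountable set of irrational $\alpha\in(0,1)$ such that, for every $\alpha$ in this set, $T_\alpha$ is ergodic (with respect to the product measure) and $\Lambda(\alpha)\geq\lambda$; in particular $\Lambda(\alpha)\neq 0$. -/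

import Mathlib

open MeasureTheory Filter

noncomputable section

namespace Staircase

/-- The skew transformation `T(y, g) = (S y, g + f y)` on `Y × G`. -/
def skewProduct {Y G : Type*} [Add G] (S : Y → Y) (f : Y → G) : Y × G → Y × G :=
  fun p => (S p.1, p.2 + f p.1)

/-- The principal Lyapunov exponent
`limsup_{n → ∞} log (ess sup_y ‖∑_{i < n} f (S^i y)‖) / log n` of the cocycle `f` over `S`,
as an extended real number (with `log 0 = -∞`). -/
def lyapunovExponent {Y G : Type*} [MeasurableSpace Y] [NormedAddCommGroup G]
    (ν : Measure Y) (S : Y → Y) (f : Y → G) : EReal :=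
  limsup (fun n : ℕ =>
    ENNReal.log (essSup (fun y => ‖birkhoffSum S f n y‖ₑ) ν) / ((Real.log n : ℝ) : EReal)) atTop

/-- The rotation `x ↦ x + α` of the circle `ℝ / ℤ`. -/
def rotation (α : ℝ) : UnitAddCircle → UnitAddCircle :=
  fun x => x + (α : UnitAddCircle)

/-- The staircase cocycle `χ_[0,1/2) - χ_[1/2,1)` on the circle `ℝ / ℤ`. -/
def staircaseCocycle : UnitAddCircle → ℤ :=
  Set.indicator ((fun t : ℝ => (t : UnitAddCircle)) '' Set.Ico 0 (1 / 2)) 1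
    - Set.indicator ((fun t : ℝ => (t : UnitAddCircle)) '' Set.Ico (1 / 2) 1) 1

/-- The infinite staircase in direction `α`: the skew product on `ℝ / ℤ × ℤ` of the rotation by
`α` with the staircase cocycle. -/
def infiniteStaircase (α : ℝ) : UnitAddCircle × ℤ → UnitAddCircle × ℤ :=
  skewProduct (rotation α) staircaseCocycle

/-- The Lyapunov exponent of the infinite staircase in direction `α`, with respect to Lebesgue
measure on the circle. -/
def staircaseLyapunovExponent (α : ℝ) : EReal :=
  lyapunovExponent (volume : Measure UnitAddCircle) (rotation α) staircaseCocycle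

end Staircase

end

/-!
A generic real `α` has rational approximations `p / q` with `q` odd that are as good as one likes in
terms of `q`. The number `q` of residues being odd, the cocycle takes the value `1` once more often
than the value `-1` along the points `j / q + w` with `0 < w < 1 / (2q)`. Off small neighbourhoods
of the multiples of `1 / (2q)`, the `q`-th Birkhoff sum is therefore `1` at `y` or at
`y - 1 / (2q)`, while the `q`-th power of the rotation and the shift by `1 / (2q)` are close to the
identity. Hence every invariant set of the skew product is invariant under `m ↦ m + 1`, and
ergodicity of the rotation gives ergodicity of the skew product.

If `α` is approximated to the order `k + 2`, the sums over `q ^ k` successive blocks of length `q`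
add up to `q ^ k` on an open set, at the time `q ^ (k + 1)`. The Lyapunov exponent is thus at least
`k / (k + 1)` for every `k`, and it is at most `1` because the cocycle is bounded.
-/

namespace Staircase

open Set Topology
open scoped symmDiff ENNReal

section SkewProduct

variable {Y G : Type*}

theorem skewProduct_iterate [AddCommMonoid G] (S : Y → Y) (f : Y → G) (n : ℕ) (p : Y × G) :
    (skewProduct S f)^[n] p = (S^[n] p.1, p.2 + birkhoffSum S f n p.1) := by
  induction n with
  | zero => simp
  | succ n ih =>
    rw [Function.iterate_succ_apply', ih, Function.iterate_succ_apply', birkhoffSum_succ,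
      ← add_assoc]
    rfl

theorem mem_iff_iterate_mem_of_birkhoffSum_eq [AddCommMonoid G] {S : Y → Y} {f : Y → G}
    {s : Set (Y × G)} (hinv : skewProduct S f ⁻¹' s = s) {n : ℕ} {y : Y} {c : G}
    (hc : birkhoffSum S f n y = c) (g : G) :
    (y, g) ∈ s ↔ (S^[n] y, g + c) ∈ s := by
  have hn : (skewProduct S f)^[n] ⁻¹' s = s := by
    rw [Set.preimage_iterate_eq]
    exact Function.iterate_fixed hinv n
  rw [← hc, ← skewProduct_iterate S f n (y, g)]
  exact (Set.ext_iff.1 hn (y, g)).symm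

variable [MeasurableSpace Y] [MeasurableSpace G] {ν : Measure Y} {S : Y → Y} {f : Y → G}

theorem measurePreserving_skewProduct [AddGroup G] [MeasurableAdd₂ G] {μ : Measure G}
    [μ.IsAddRightInvariant] [SFinite μ] [SFinite ν] (hS : MeasurePreserving S ν ν)
    (hf : Measurable f) :
    MeasurePreserving (skewProduct S f) (ν.prod μ) (ν.prod μ) :=
  hS.skew_product (g := fun y g => g + f y) (measurable_snd.add (hf.comp measurable_fst))
    (ae_of_all _ fun y => (measurePreserving_add_right μ (f y)).map_eq)

theorem ae_eq_prod_count_of_forall_fiber [Countable G] {s t : Set (Y × G)}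
    (hs : MeasurableSet s) (ht : MeasurableSet t) (h : ∀ g, (·, g) ⁻¹' s =ᵐ[ν] (·, g) ⁻¹' t) :
    s =ᵐ[ν.prod Measure.count] t := by
  rw [← measure_symmDiff_eq_zero_iff, Measure.measure_prod_null (hs.symmDiff ht)]
  filter_upwards [ae_all_iff.2 fun g => (h g).mem_iff] with y hy
  refine Measure.count_eq_zero_iff.2 (eq_empty_of_forall_notMem fun g hg => ?_)
  exact hg.elim (fun hg => hg.2 ((hy g).1 hg.1)) fun hg => hg.2 ((hy g).2 hg.1)

/-- The group of `a : G` such that translation by `a` in the `G`-coordinate preserves, up to null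
sets, every measurable set invariant under the skew product of `S` and `f`. For ergodic `S` and
countable abelian `G` it is Schmidt's group of essential values of the cocycle `f`. Sets are
compared through their fibers over `G`, so that no measure on `G` is involved. -/
def essentialPeriods [AddGroup G] (ν : Measure Y) (S : Y → Y) (f : Y → G) : AddSubgroup G where
  carrier := {a | ∀ s : Set (Y × G), MeasurableSet s → skewProduct S f ⁻¹' s = s →
    ∀ g, (·, g) ⁻¹' s =ᵐ[ν] (·, g + a) ⁻¹' s}
  zero_mem' s _ _ g := by simpa only [add_zero] using ae_eq_refl _
  add_mem' {a b} ha hb s hs hinv g := by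
    simpa only [add_assoc] using (ha s hs hinv g).trans (hb s hs hinv (g + a))
  neg_mem' {a} ha s hs hinv g := by
    simpa only [neg_add_cancel_right] using (ha s hs hinv (g + -a)).symm

theorem ergodic_skewProduct [AddGroup G] [Countable G] [MeasurableSingletonClass G]
    [MeasurableAdd₂ G] [SFinite ν] (hS : Ergodic S ν) (hf : Measurable f)
    (hperiods : essentialPeriods ν S f = ⊤) :
    Ergodic (skewProduct S f) (ν.prod Measure.count) := by
  refine ⟨measurePreserving_skewProduct hS.toMeasurePreserving hf, ⟨fun s hs hinv => ?_⟩⟩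
  have hfiber (g : G) : (·, g) ⁻¹' s =ᵐ[ν] (·, (0 : G)) ⁻¹' s := by
    have hg : g ∈ essentialPeriods ν S f := hperiods ▸ AddSubgroup.mem_top g
    simpa only [zero_add] using (hg s hs hinv 0).symm
  have hfiber_all : ∀ᵐ y ∂ν, ∀ g, (y, g) ∈ s ↔ (y, (0 : G)) ∈ s :=
    ae_all_iff.2 fun g => (hfiber g).mem_iff
  have hfiber_inv : S ⁻¹' ((·, (0 : G)) ⁻¹' s) =ᵐ[ν] (·, (0 : G)) ⁻¹' s := by
    refine Eventually.set_eq ?_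
    filter_upwards [hS.quasiMeasurePreserving.ae hfiber_all] with y hy
    calc (S y, (0 : G)) ∈ s ↔ skewProduct S f (y, 0) ∈ s := (hy (0 + f y)).symm
      _ ↔ (y, 0) ∈ s := Set.ext_iff.1 hinv (y, 0)
  refine eventuallyConst_set'.2 ((hS.quasiErgodic.ae_empty_or_univ₀
    (measurable_prodMk_right hs).nullMeasurableSet hfiber_inv).imp (fun h => ?_) fun h => ?_)
  · exact ae_eq_prod_count_of_forall_fiber hs .empty fun g => (hfiber g).trans h
  · exact ae_eq_prod_count_of_forall_fiber hs .univ fun g => (hfiber g).trans h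

end SkewProduct

section Rigidity

variable {ι Y G : Type*} [MeasurableSpace Y] {ν : Measure Y} {l : Filter ι}

/-- The self-maps `τ i` of `Y` converge along `l` to the identity in the measure algebra of `ν`.
For powers `τ i = S^[n i]` of a single map this is rigidity of `S` along `n`. -/
def TendstoIdInMeasure (ν : Measure Y) (τ : ι → Y → Y) (l : Filter ι) : Prop :=
  ∀ s, MeasurableSet s → Tendsto (fun i => ν ((τ i ⁻¹' s) ∆ s)) l (𝓝 0)

theorem tendstoIdInMeasure_add_right [AddGroup Y] [TopologicalSpace Y] [IsTopologicalAddGroup Y]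
    [BorelSpace Y] [ν.IsAddRightInvariant] [ν.InnerRegularCompactLTTop] [IsFiniteMeasure ν]
    {x : ι → Y} (hx : Tendsto x l (𝓝 0)) :
    TendstoIdInMeasure ν (fun i y => y + x i) l := by
  intro s hs
  let translation (t : Y) : C(Y, Y) := ⟨(· + t), continuous_add_const t⟩
  have htranslation : Continuous translation :=
    ContinuousMap.continuous_of_continuous_uncurry _ (continuous_snd.add continuous_fst)
  simpa [translation] using tendsto_measure_symmDiff_preimage_nhds_zero
    ((htranslation.tendsto 0).comp hx)
    (Eventually.of_forall fun i => measurePreserving_add_right ν (x i))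
    (measurePreserving_add_right ν 0) hs.nullMeasurableSet (measure_ne_top ν s)

theorem measure_le_of_subset_union {τ : Y → Y} (hτ : MeasurePreserving τ ν ν) {D N M : Set Y}
    (hM : NullMeasurableSet M ν) (hD : D ⊆ N ∪ M) :
    ν D ≤ ν (N ∩ τ ⁻¹' N) + (ν M + (ν ((τ ⁻¹' D) ∆ D) + ν M)) := by
  have hcover : D ⊆ N ∩ τ ⁻¹' N ∪ (M ∪ ((τ ⁻¹' D) ∆ D ∪ τ ⁻¹' M)) := by
    intro y hy
    rcases hD hy with hN | hM
    · by_cases hyτ : τ y ∈ D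
      · rcases hD hyτ with hNτ | hMτ
        · exact .inl ⟨hN, hNτ⟩
        · exact .inr (.inr (.inr hMτ))
      · exact .inr (.inr (.inl (.inr ⟨hy, hyτ⟩)))
    · exact .inr (.inl hM)
  calc ν D ≤ ν (N ∩ τ ⁻¹' N) + (ν M + (ν ((τ ⁻¹' D) ∆ D) + ν (τ ⁻¹' M))) := by
        refine (measure_mono hcover).trans <| (measure_union_le _ _).trans ?_
        gcongr
        refine (measure_union_le _ _).trans ?_
        gcongr
        exact measure_union_le _ _
    _ = ν (N ∩ τ ⁻¹' N) + (ν M + (ν ((τ ⁻¹' D) ∆ D) + ν M)) := by rw [hτ.measure_preimage hM]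

/-- Where the `n i`-th Birkhoff sum is `c`, the fibers of an invariant set over `g` and `g + c`
differ only because `S^[n i]` moves points a little. Near-invariance of the difference of the two
fibers under `τ i` then controls it on the preimage under `τ i` as well. -/
theorem mem_essentialPeriods_of_tendsto [AddCommGroup G] [MeasurableSpace G] [l.NeBot]
    {S : Y → Y} {f : Y → G} (hS : Measurable S)
    {n : ι → ℕ} {τ : ι → Y → Y} {c : G} (hSn : TendstoIdInMeasure ν (fun i => S^[n i]) l)
    (hτ : ∀ i, MeasurePreserving (τ i) ν ν) (hτ_id : TendstoIdInMeasure ν τ l)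
    (hc : Tendsto (fun i => ν {y | birkhoffSum S f (n i) y ≠ c ∧
      birkhoffSum S f (n i) (τ i y) ≠ c}) l (𝓝 0)) :
    c ∈ essentialPeriods ν S f := by
  intro s hs hinv g
  set E : Set Y := (·, g) ⁻¹' s
  set F : Set Y := (·, g + c) ⁻¹' s
  have hE : MeasurableSet E := measurable_prodMk_right hs
  have hF : MeasurableSet F := measurable_prodMk_right hs
  have hmoved (i : ι) : E ∆ F ⊆ {y | birkhoffSum S f (n i) y ≠ c} ∪ (S^[n i] ⁻¹' F) ∆ F := by
    refine fun y hy => or_iff_not_imp_left.2 fun hy_eq => ?_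
    have hiff : y ∈ E ↔ y ∈ S^[n i] ⁻¹' F :=
      mem_iff_iterate_mem_of_birkhoffSum_eq hinv (not_not.1 hy_eq) g
    simpa only [mem_symmDiff, hiff] using hy
  have hlim := hc.add ((hSn F hF).add ((hτ_id _ (hE.symmDiff hF)).add (hSn F hF)))
  simp only [add_zero] at hlim
  exact measure_symmDiff_eq_zero_iff.1 <| le_antisymm (ge_of_tendsto' hlim fun i =>
    measure_le_of_subset_union (hτ i) ((hS.iterate (n i) hF).symmDiff hF).nullMeasurableSet
      (hmoved i)) zero_le

end Rigidity

section LyapunovExponent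

theorem log_natCast_rpow {n : ℕ} (hn : n ≠ 0) (c : ℝ) :
    ENNReal.log ((n : ℝ≥0∞) ^ c) = c * (Real.log n : ℝ) := by
  rw [ENNReal.log_rpow, ← ENNReal.ofReal_natCast,
    ENNReal.log_ofReal_of_pos (Nat.cast_pos.2 (Nat.pos_of_ne_zero hn))]

theorem le_log_div_log_natCast_iff {n : ℕ} (hn : 1 < n) {c : ℝ} {x : ℝ≥0∞} :
    (c : EReal) ≤ ENNReal.log x / (Real.log n : ℝ) ↔ (n : ℝ≥0∞) ^ c ≤ x := by
  have hlog : 0 < Real.log n := Real.log_pos (Nat.one_lt_cast.2 hn)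
  rw [EReal.le_div_iff_mul_le (EReal.coe_pos.2 hlog) (EReal.coe_ne_top _),
    ← log_natCast_rpow (by omega), ENNReal.log_le_log_iff]

theorem log_div_log_natCast_le_iff {n : ℕ} (hn : 1 < n) {c : ℝ} {x : ℝ≥0∞} :
    ENNReal.log x / (Real.log n : ℝ) ≤ (c : EReal) ↔ x ≤ (n : ℝ≥0∞) ^ c := by
  have hlog : 0 < Real.log n := Real.log_pos (Nat.one_lt_cast.2 hn)
  rw [EReal.div_le_iff_le_mul (EReal.coe_pos.2 hlog) (EReal.coe_ne_top _), mul_comm,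
    ← log_natCast_rpow (by omega), ENNReal.log_le_log_iff]

theorem le_essSup_of_isOpen {Y : Type*} [TopologicalSpace Y] [MeasurableSpace Y] {ν : Measure Y}
    [ν.IsOpenPosMeasure] {g : Y → ℝ≥0∞} {c : ℝ≥0∞} {U : Set Y} (hU : IsOpen U)
    (hne : U.Nonempty) (hg : ∀ y ∈ U, c ≤ g y) : c ≤ essSup g ν :=
  le_limsup_of_frequently_le' <| frequently_ae_iff.2 fun h =>
    hU.measure_ne_zero ν hne (measure_mono_null hg h)

variable {Y G : Type*} [MeasurableSpace Y] [NormedAddCommGroup G] {ν : Measure Y} {S : Y → Y}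
  {f : Y → G}

theorem le_lyapunovExponent_of_frequently {c : ℝ}
    (h : ∃ᶠ n : ℕ in atTop, (n : ℝ≥0∞) ^ c ≤ essSup (fun y => ‖birkhoffSum S f n y‖ₑ) ν) :
    (c : EReal) ≤ lyapunovExponent ν S f :=
  le_limsup_of_frequently_le' <| (h.and_eventually (eventually_gt_atTop 1)).mono fun _ hn =>
    (le_log_div_log_natCast_iff hn.2).2 hn.1

theorem lyapunovExponent_le_one (hf : ∀ y, ‖f y‖ₑ ≤ 1) : lyapunovExponent ν S f ≤ 1 := by
  refine limsup_le_of_le (h := ?_)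
  filter_upwards [eventually_gt_atTop 1] with n hn
  refine (log_div_log_natCast_le_iff hn).2 (essSup_le_of_ae_le _ <| ae_of_all _ fun y => ?_)
  calc ‖birkhoffSum S f n y‖ₑ ≤ ∑ i ∈ Finset.range n, ‖f (S^[i] y)‖ₑ := enorm_sum_le _ _
    _ ≤ ∑ _i ∈ Finset.range n, 1 := Finset.sum_le_sum fun i _ => hf _
    _ = (n : ℝ≥0∞) ^ (1 : ℝ) := by simp

end LyapunovExponent

section Cocycle

theorem injOn_coe_Ico : InjOn (fun t : ℝ => (t : UnitAddCircle)) (Ico 0 1) := fun _ hs _ ht h =>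
  (AddCircle.coe_eq_coe_iff_of_mem_Ico (a := 0) (p := 1) (by simpa using hs)
    (by simpa using ht)).1 h

theorem staircaseCocycle_coe {t : ℝ} (ht : t ∈ Ico 0 1) :
    staircaseCocycle t = if t < 1 / 2 then 1 else -1 := by
  have hleft : ((t : UnitAddCircle) ∈ (fun t : ℝ => (t : UnitAddCircle)) '' Ico 0 (1 / 2)) ↔
      t < 1 / 2 :=
    (injOn_coe_Ico.mem_image_iff (Ico_subset_Ico_right (by norm_num)) ht).trans
      (and_iff_right ht.1)
  have hright : ((t : UnitAddCircle) ∈ (fun t : ℝ => (t : UnitAddCircle)) '' Ico (1 / 2) 1) ↔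
      ¬ t < 1 / 2 :=
    (injOn_coe_Ico.mem_image_iff (Ico_subset_Ico_left (by norm_num)) ht).trans
      ((and_iff_left ht.2).trans not_lt.symm)
  by_cases h : t < 1 / 2 <;>
    simp [staircaseCocycle, indicator, hleft, hright, h, -one_div]

theorem measurable_staircaseCocycle : Measurable staircaseCocycle := by
  have himage {a b : ℝ} (h : Ico a b ⊆ Ico 0 1) :
      MeasurableSet ((fun t : ℝ => (t : UnitAddCircle)) '' Ico a b) :=
    measurableSet_Ico.image_of_continuousOn_injOn (AddCircle.continuous_mk' 1).continuousOn
      (injOn_coe_Ico.mono h)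
  exact (measurable_one.indicator (himage (Ico_subset_Ico_right (by norm_num)))).sub
    (measurable_one.indicator (himage (Ico_subset_Ico_left (by norm_num))))

theorem enorm_staircaseCocycle (y : UnitAddCircle) : ‖staircaseCocycle y‖ₑ = 1 := by
  obtain ⟨t, ht, rfl⟩ : y ∈ (fun t : ℝ => (t : UnitAddCircle)) '' Ico 0 (0 + 1) :=
    AddCircle.coe_image_Ico_eq (1 : ℝ) 0 ▸ mem_univ y
  rw [zero_add] at ht
  rw [staircaseCocycle_coe ht]
  split_ifs <;> simp

theorem rotation_iterate (α : ℝ) (n : ℕ) (x : UnitAddCircle) :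
    (rotation α)^[n] x = x + ((n * α : ℝ) : UnitAddCircle) := by
  rw [← nsmul_eq_mul, AddCircle.coe_nsmul]
  exact congrFun (add_right_iterate _ n) x

end Cocycle

section ResidueSign

variable {q : ℕ}

/-- The value of the staircase cocycle on the arc `[r / q, r / q + 1 / (2q))`. -/
def residueSign (r : ZMod q) : ℤ :=
  if 2 * r.val < q then 1 else -1

theorem sum_residueSign [NeZero q] (hq : Odd q) : ∑ r : ZMod q, residueSign r = 1 := by
  have hpair (r : ZMod q) : residueSign r + residueSign (-r) = if r = 0 then 2 else 0 := by
    obtain ⟨m, hm⟩ := hq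
    by_cases hr : r = 0
    · simp [hr, residueSign, NeZero.pos q]
    · have hval : r.val < q := r.val_lt
      have hneg : (-r).val = q - r.val := by rw [ZMod.neg_val, if_neg hr]
      simp only [residueSign, hneg, hr, if_false]
      split_ifs <;> omega
  have hdouble : ∑ r : ZMod q, residueSign r + ∑ r : ZMod q, residueSign r = 2 := by
    nth_rw 2 [← Equiv.sum_comp (Equiv.neg (ZMod q))]
    simp only [Equiv.neg_apply, ← Finset.sum_add_distrib, hpair, Finset.sum_ite_eq',
      Finset.mem_univ, if_true]
  omega

theorem sum_range_add_natCast_mul [NeZero q] {M : Type*} [AddCommMonoid M] {u : ZMod q}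
    (hu : IsUnit u) (k : ZMod q) (g : ZMod q → M) :
    ∑ i ∈ Finset.range q, g (k + i * u) = ∑ r, g r := by
  have hcast : ∑ i ∈ Finset.range q, g (k + i * u) = ∑ j : ZMod q, g (k + j * u) :=
    Finset.sum_nbij' (fun i => (i : ZMod q)) ZMod.val (by simp) (by simp [ZMod.val_lt])
      (fun i hi => ZMod.val_cast_of_lt (Finset.mem_range.1 hi)) (by simp) (by simp)
  rw [hcast]
  exact Equiv.sum_comp (hu.unit.mulRight.trans (Equiv.addLeft k)) g

theorem staircaseCocycle_toAddCircle_add [NeZero q] (r : ZMod q) {w : ℝ} (hw0 : 0 ≤ w)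
    (hw : w < 1 / (2 * q)) :
    staircaseCocycle (ZMod.toAddCircle r + (w : UnitAddCircle)) = residueSign r := by
  have hq : (0 : ℝ) < q := Nat.cast_pos.2 (NeZero.pos q)
  have hwq : w * (2 * q) < 1 := (lt_div_iff₀ (by positivity)).1 hw
  have hval : (r.val : ℝ) + 1 ≤ q := mod_cast r.val_lt
  have hscale : ((r.val : ℝ) / q + w) * q = r.val + w * q := by field_simp
  have hmem : (r.val : ℝ) / q + w ∈ Ico 0 1 := ⟨by positivity, by nlinarith⟩
  have hhalf : (r.val : ℝ) / q + w < 1 / 2 ↔ 2 * r.val < q := by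
    constructor <;> intro h
    · have : (2 * r.val : ℝ) < q := by nlinarith
      exact_mod_cast this
    · have : (2 * r.val + 1 : ℝ) ≤ q := mod_cast h
      nlinarith
  rw [ZMod.toAddCircle_apply, ← AddCircle.coe_add, staircaseCocycle_coe hmem, residueSign]
  simp only [hhalf]

end ResidueSign

section RationalApproximation

variable {p : ℤ} {q : ℕ} [NeZero q] {α : ℝ}

theorem coe_natCast_mul_eq_toAddCircle_add (i : ℕ) :
    ((i * α : ℝ) : UnitAddCircle) =
      ZMod.toAddCircle ((i : ZMod q) * (p : ZMod q)) + ((i * (α - p / q) : ℝ) : UnitAddCircle) := by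
  have hcast : (i : ZMod q) * p = ((i * p : ℤ) : ZMod q) := by push_cast; rfl
  rw [hcast, ZMod.toAddCircle_intCast, ← AddCircle.coe_add]
  congr 1
  push_cast
  ring

theorem rotation_iterate_toAddCircle_add (i : ℕ) (k : ZMod q) (w : ℝ) :
    (rotation α)^[i] (ZMod.toAddCircle k + (w : UnitAddCircle)) =
      ZMod.toAddCircle (k + (i : ZMod q) * (p : ZMod q)) +
        ((w + i * (α - p / q) : ℝ) : UnitAddCircle) := by
  rw [rotation_iterate, coe_natCast_mul_eq_toAddCircle_add (p := p) (q := q), map_add,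
    AddCircle.coe_add]
  abel

/-- The orbit segment visits each arc `[r / q, r / q + 1 / (2q))` exactly once. -/
theorem birkhoffSum_staircaseCocycle_eq_one (hq : Odd q) (hpq : IsCoprime (q : ℤ) p) (k : ZMod q)
    {w : ℝ} (hw₀ : q * |α - p / q| ≤ w) (hw₁ : w + q * |α - p / q| < 1 / (2 * q)) :
    birkhoffSum (rotation α) staircaseCocycle q (ZMod.toAddCircle k + (w : UnitAddCircle)) = 1 := by
  have hterm (i : ℕ) (hi : i ∈ Finset.range q) :
      staircaseCocycle ((rotation α)^[i] (ZMod.toAddCircle k + (w : UnitAddCircle))) =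
        residueSign (k + (i : ZMod q) * (p : ZMod q)) := by
    have hdrift : |i * (α - p / q)| ≤ q * |α - p / q| := by
      rw [abs_mul, Nat.abs_cast]
      gcongr
      exact (Finset.mem_range.1 hi).le
    rw [rotation_iterate_toAddCircle_add]
    exact staircaseCocycle_toAddCircle_add _ (by linarith [neg_le_of_abs_le hdrift])
      (by linarith [le_of_abs_le hdrift])
  rw [birkhoffSum, Finset.sum_congr rfl hterm,
    sum_range_add_natCast_mul ((ZMod.coe_int_isUnit_iff_isCoprime p q).2 hpq), sum_residueSign hq]

theorem birkhoffSum_staircaseCocycle_mul (hq : Odd q) (hpq : IsCoprime (q : ℤ) p) (k : ZMod q)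
    {w : ℝ} (m : ℕ) (hw₀ : m * (q * |α - p / q|) ≤ w)
    (hw₁ : w + m * (q * |α - p / q|) < 1 / (2 * q)) :
    birkhoffSum (rotation α) staircaseCocycle (m * q) (ZMod.toAddCircle k + (w : UnitAddCircle)) =
      m := by
  induction m with
  | zero => simp
  | succ m ih =>
    have hδ : 0 ≤ q * |α - p / q| := by positivity
    have hdrift : |((m * q : ℕ) : ℝ) * (α - p / q)| = m * (q * |α - p / q|) := by
      rw [abs_mul, Nat.abs_cast]
      push_cast
      ring
    push_cast at hw₀ hw₁
    rw [add_mul, one_mul, birkhoffSum_add, ih (by linarith) (by linarith),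
      rotation_iterate_toAddCircle_add (p := p), birkhoffSum_staircaseCocycle_eq_one hq hpq]
    · push_cast
      rfl
    · linarith [neg_le_of_abs_le hdrift.le]
    · linarith [le_of_abs_le hdrift.le]

theorem natCast_le_essSup_birkhoffSum_mul (hq : Odd q) (hpq : IsCoprime (q : ℤ) p) {m : ℕ}
    (hm : 4 * (m * (q ^ 2 * |α - p / q|)) < 1) :
    (m : ℝ≥0∞) ≤
      essSup (fun y => ‖birkhoffSum (rotation α) staircaseCocycle (m * q) y‖ₑ) volume := by
  have hq₀ : (0 : ℝ) < q := Nat.cast_pos.2 (NeZero.pos q)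
  set δ : ℝ := m * (q * |α - p / q|) with hδ
  have hlt : δ < 1 / (2 * q) - δ := by
    rw [lt_sub_iff_add_lt, lt_div_iff₀ (by positivity)]
    calc (δ + δ) * (2 * q) = 4 * (m * (q ^ 2 * |α - p / q|)) := by rw [hδ]; ring
      _ < 1 := hm
  refine le_essSup_of_isOpen
    (QuotientAddGroup.isOpenMap_coe _ (isOpen_Ioo (a := δ) (b := 1 / (2 * q) - δ)))
    ((nonempty_Ioo.2 hlt).image _) ?_
  rintro _ ⟨w, hw, rfl⟩
  have hsum : birkhoffSum (rotation α) staircaseCocycle (m * q) (w : UnitAddCircle) = m := by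
    simpa only [map_zero, zero_add] using
      birkhoffSum_staircaseCocycle_mul hq hpq 0 m hw.1.le (lt_sub_iff_add_lt.1 hw.2)
  exact (congrArg enorm hsum).symm ▸ (by simp)

/-- The bad set is a neighbourhood of the multiples of `1 / (2q)`: the remaining arcs between them
alternate between those where the Birkhoff sum is `1` and their translates by `1 / (2q)`. -/
theorem birkhoffSum_staircaseCocycle_eq_one_or_sub (hq : Odd q) (hpq : IsCoprime (q : ℤ) p)
    {y : UnitAddCircle} (hy : 2 * q * (q * |α - p / q|) < ‖(2 * q) • y‖) :
    birkhoffSum (rotation α) staircaseCocycle q y = 1 ∨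
      birkhoffSum (rotation α) staircaseCocycle q (y - ((1 / (2 * q) : ℝ) : UnitAddCircle)) =
        1 := by
  obtain ⟨t, rfl⟩ := QuotientAddGroup.mk_surjective y
  have hq₀ : (0 : ℝ) < 2 * q := by have := NeZero.pos q; positivity
  set δ : ℝ := q * |α - p / q|
  set w : ℝ := Int.fract (2 * q * t) / (2 * q) with hw
  have hmin : 2 * q * δ < min (Int.fract (2 * q * t)) (1 - Int.fract (2 * q * t)) := by
    rw [← abs_sub_round_eq_min, ← UnitAddCircle.norm_eq]
    convert hy
    rw [← Nat.cast_ofNat, ← Nat.cast_mul, ← nsmul_eq_mul]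
    rfl
  have hδw : δ < w := by
    rw [lt_div_iff₀ hq₀]
    linarith [hmin.trans_le (min_le_left _ _)]
  have hwδ : w + δ < 1 / (2 * q) := by
    rw [← lt_sub_iff_add_lt', hw, ← sub_div, lt_div_iff₀ hq₀]
    linarith [hmin.trans_le (min_le_right _ _)]
  have ht : t = ⌊2 * q * t⌋ / (2 * q) + w := by
    rw [hw, ← add_div, Int.floor_add_fract, mul_div_cancel_left₀ t hq₀.ne']
  have hsum (i : ℤ) :
      birkhoffSum (rotation α) staircaseCocycle q ((i / q + w : ℝ) : UnitAddCircle) = 1 := by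
    rw [AddCircle.coe_add, ← ZMod.toAddCircle_intCast]
    exact birkhoffSum_staircaseCocycle_eq_one hq hpq _ hδw.le hwδ
  obtain ⟨i, hi | hi⟩ := Int.even_or_odd' ⌊2 * q * t⌋
  · have ht_even : t = i / q + w := ht.trans (by rw [hi]; push_cast; field_simp)
    exact .inl (ht_even ▸ hsum i :)
  · have ht_odd : t - 1 / (2 * q) = i / q + w := by
      rw [sub_eq_iff_eq_add]
      exact ht.trans (by rw [hi]; push_cast; field_simp; ring)
    exact .inr (ht_odd ▸ hsum i :)

theorem volume_setOf_birkhoffSum_staircaseCocycle_ne_one_le (hq : Odd q)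
    (hpq : IsCoprime (q : ℤ) p) :
    volume {y | birkhoffSum (rotation α) staircaseCocycle q y ≠ 1 ∧
      birkhoffSum (rotation α) staircaseCocycle q (y - ((1 / (2 * q) : ℝ) : UnitAddCircle)) ≠ 1} ≤
      ENNReal.ofReal (4 * (q ^ 2 * |α - p / q|)) := by
  set ε : ℝ := 2 * q * (q * |α - p / q|) with hε
  have hsubset : {y | birkhoffSum (rotation α) staircaseCocycle q y ≠ 1 ∧
      birkhoffSum (rotation α) staircaseCocycle q (y - ((1 / (2 * q) : ℝ) : UnitAddCircle)) ≠ 1} ⊆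
      ((2 * q) • · : UnitAddCircle → UnitAddCircle) ⁻¹' Metric.closedBall 0 ε := by
    rintro y ⟨hy, hy_sub⟩
    rw [mem_preimage, mem_closedBall_zero_iff]
    exact not_lt.1 fun h =>
      (birkhoffSum_staircaseCocycle_eq_one_or_sub hq hpq h).elim hy hy_sub
  have hmul : MeasurePreserving ((2 * q) • · : UnitAddCircle → UnitAddCircle) volume volume :=
    (AddCircle.ergodic_nsmul (by have := NeZero.pos q; omega)).toMeasurePreserving
  calc _ ≤ volume (((2 * q) • · : UnitAddCircle → UnitAddCircle) ⁻¹' Metric.closedBall 0 ε) :=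
        measure_mono hsubset
    _ = volume (Metric.closedBall (0 : UnitAddCircle) ε) :=
        hmul.measure_preimage Metric.isClosed_closedBall.measurableSet.nullMeasurableSet
    _ ≤ ENNReal.ofReal (2 * ε) := by
        rw [AddCircle.volume_closedBall]
        exact ENNReal.ofReal_le_ofReal (min_le_right _ _)
    _ = ENNReal.ofReal (4 * (q ^ 2 * |α - p / q|)) := by rw [hε]; ring_nf

end RationalApproximation
section OddApproximation

variable {k : ℕ} {α : ℝ} {r : ℚ}

/-- The rational `r` has odd denominator and approximates `α` to the order `k + 2` in the
denominator. -/
def IsOddApprox (k : ℕ) (α : ℝ) (r : ℚ) : Prop :=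
  Odd r.den ∧ r.den ^ (k + 2) * |α - r| < 1 / 4

/-- The number `α` has rational approximations of odd, arbitrarily large denominator to the order
`k + 2`. Such `α` form a dense `G_δ` set. -/
def OddApproximable (k : ℕ) (α : ℝ) : Prop :=
  ∃ᶠ r in comap Rat.den atTop, IsOddApprox k α r

theorem IsOddApprox.mono {j : ℕ} (h : IsOddApprox k α r) (hj : j ≤ k) : IsOddApprox j α r := by
  refine ⟨h.1, lt_of_le_of_lt ?_ h.2⟩
  gcongr
  exact mod_cast r.den_pos

theorem OddApproximable.irrational (h : OddApproximable k α) : Irrational α := by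
  have hcofinite : comap Rat.den atTop ≤ cofinite :=
    Nat.cofinite_eq_atTop ▸ comap_cofinite_le Rat.den
  refine (Real.infinite_rat_abs_sub_lt_one_div_den_sq_iff_irrational α).1 <|
    frequently_cofinite_iff_infinite.1 <| (h.filter_mono hcofinite).mono fun r hr => ?_
  have hden : (0 : ℝ) < (r.den : ℝ) ^ 2 := pow_pos (Nat.cast_pos.2 r.den_pos) 2
  rw [lt_div_iff₀' hden]
  exact (hr.mono k.zero_le).2.trans (by norm_num)

theorem OddApproximable.le_staircaseLyapunovExponent (h : OddApproximable k α) :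
    ((k / (k + 1) : ℝ) : EReal) ≤ staircaseLyapunovExponent α := by
  have htendsto : Tendsto (fun r : ℚ => r.den ^ (k + 1)) (comap Rat.den atTop) atTop :=
    (tendsto_pow_atTop k.succ_ne_zero).comp tendsto_comap
  refine le_lyapunovExponent_of_frequently (htendsto.frequently (h.mono fun r hr => ?_))
  have : NeZero r.den := ⟨r.den_nz⟩
  have hpow : ((r.den ^ (k + 1) : ℕ) : ℝ≥0∞) ^ (k / (k + 1) : ℝ) = (r.den ^ k : ℕ) := by
    rw [Nat.cast_pow, Nat.cast_pow, ← ENNReal.rpow_natCast, ← ENNReal.rpow_mul,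
      ← ENNReal.rpow_natCast]
    congr 1
    push_cast
    field_simp
  rw [hpow, pow_succ]
  refine natCast_le_essSup_birkhoffSum_mul hr.1 (Rat.isCoprime_num_den r).symm ?_
  have happrox := hr.2
  rw [pow_add, mul_assoc] at happrox
  rw [← Rat.cast_def, Nat.cast_pow]
  linarith

theorem staircaseLyapunovExponent_eq_one (h : ∀ k, OddApproximable k α) :
    staircaseLyapunovExponent α = 1 := by
  refine le_antisymm (lyapunovExponent_le_one fun y => (enorm_staircaseCocycle y).le) ?_
  have hlim : Tendsto (fun k : ℕ => ((k / (k + 1) : ℝ) : EReal)) atTop (𝓝 ((1 : ℝ) : EReal)) :=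
    (continuous_coe_real_ereal.tendsto 1).comp (tendsto_natCast_div_add_atTop (1 : ℝ))
  exact le_of_tendsto' hlim fun k => (h k).le_staircaseLyapunovExponent

theorem ergodic_rotation (h : Irrational α) : Ergodic (rotation α) volume := by
  refine AddCircle.ergodic_add_right.2 (AddCircle.denseRange_zsmul_iff.1 ?_)
  exact AddCircle.denseRange_zsmul_coe_iff.2 (by simpa using h)

section Limits

variable {l : Filter ℚ}

theorem tendsto_den_sq_mul_abs_sub (hden : Tendsto Rat.den l atTop)
    (happrox : ∀ᶠ r in l, IsOddApprox 1 α r) :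
    Tendsto (fun r : ℚ => r.den ^ 2 * |α - r|) l (𝓝 0) := by
  refine squeeze_zero' (Eventually.of_forall fun r => by positivity) (happrox.mono fun r hr => ?_)
    (tendsto_inv_atTop_nhds_zero_nat.comp hden : Tendsto (fun r : ℚ => (r.den : ℝ)⁻¹) l (𝓝 0))
  rw [Function.comp_apply, ← one_div, le_div_iff₀' (Nat.cast_pos.2 r.den_pos), ← mul_assoc,
    ← pow_succ']
  exact hr.2.le.trans (by norm_num)

theorem tendsto_coe_den_mul (h : Tendsto (fun r : ℚ => r.den ^ 2 * |α - r|) l (𝓝 0)) :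
    Tendsto (fun r : ℚ => ((r.den * α : ℝ) : UnitAddCircle)) l (𝓝 0) := by
  have hreal : Tendsto (fun r : ℚ => r.den * (α - r)) l (𝓝 0) := by
    refine squeeze_zero_norm (fun r => ?_) h
    have hden : (1 : ℝ) ≤ r.den := mod_cast r.den_pos
    rw [norm_mul, Real.norm_natCast, Real.norm_eq_abs]
    gcongr
    exact le_self_pow₀ hden two_ne_zero
  refine (((AddCircle.continuous_mk' (1 : ℝ)).tendsto 0).comp hreal).congr fun r => ?_
  have : NeZero r.den := ⟨r.den_nz⟩
  rw [coe_natCast_mul_eq_toAddCircle_add (p := r.num) (q := r.den), ← Rat.cast_def]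
  simp

theorem tendsto_coe_one_div_two_mul_den (hden : Tendsto Rat.den l atTop) :
    Tendsto (fun r : ℚ => ((1 / (2 * r.den) : ℝ) : UnitAddCircle)) l (𝓝 0) := by
  have hreal : Tendsto (fun r : ℚ => (1 / (2 * r.den) : ℝ)) l (𝓝 0) :=
    tendsto_const_nhds.div_atTop
      ((tendsto_natCast_atTop_atTop.comp hden).const_mul_atTop two_pos)
  exact ((AddCircle.continuous_mk' (1 : ℝ)).tendsto 0).comp hreal

end Limits

theorem OddApproximable.one_mem_essentialPeriods (h : OddApproximable 1 α) :
    1 ∈ essentialPeriods volume (rotation α) staircaseCocycle := by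
  have : (comap Rat.den atTop ⊓ 𝓟 {r | IsOddApprox 1 α r}).NeBot := frequently_iff_neBot.1 h
  set l : Filter ℚ := comap Rat.den atTop ⊓ 𝓟 {r | IsOddApprox 1 α r}
  have hden : Tendsto Rat.den l atTop := tendsto_comap.mono_left inf_le_left
  have happrox : ∀ᶠ r in l, IsOddApprox 1 α r := mem_inf_of_right (mem_principal_self _)
  have hsmall := tendsto_den_sq_mul_abs_sub hden happrox
  have hbound : Tendsto (fun r : ℚ => ENNReal.ofReal (4 * (r.den ^ 2 * |α - r|))) l (𝓝 0) := by
    simpa using ENNReal.tendsto_ofReal (hsmall.const_mul 4)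
  have hrigid : TendstoIdInMeasure volume (fun r : ℚ => (rotation α)^[r.den]) l := by
    simpa only [← rotation_iterate] using tendstoIdInMeasure_add_right (tendsto_coe_den_mul hsmall)
  have hshift : TendstoIdInMeasure volume
      (fun (r : ℚ) (y : UnitAddCircle) => y - ((1 / (2 * r.den) : ℝ) : UnitAddCircle)) l := by
    simpa only [sub_eq_add_neg] using tendstoIdInMeasure_add_right
      (by simpa only [neg_zero] using (tendsto_coe_one_div_two_mul_den hden).neg)
  refine mem_essentialPeriods_of_tendsto (ergodic_rotation h.irrational).measurable hrigid
    (fun r => measurePreserving_sub_right _ _) hshift <|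
    tendsto_of_tendsto_of_tendsto_of_le_of_le' tendsto_const_nhds hbound
      (Eventually.of_forall fun _ => zero_le) (happrox.mono fun r hr => ?_)
  have : NeZero r.den := ⟨r.den_nz⟩
  simpa only [← Rat.cast_def r] using
    volume_setOf_birkhoffSum_staircaseCocycle_ne_one_le hr.1 (Rat.isCoprime_num_den r).symm

theorem OddApproximable.ergodic_infiniteStaircase (h : OddApproximable 1 α) :
    Ergodic (infiniteStaircase α) (volume.prod Measure.count) := by
  refine ergodic_skewProduct (ergodic_rotation h.irrational) measurable_staircaseCocycle ?_
  refine (AddSubgroup.eq_top_iff' _).2 fun a => ?_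
  simpa using AddSubgroup.zsmul_mem _ h.one_mem_essentialPeriods a

end OddApproximation

section Genericity

theorem den_three_mul_add_one_div (j : ℤ) (n : ℕ) :
    (((3 * j + 1 : ℤ) / (3 ^ n : ℤ) : ℚ)).den = 3 ^ n := by
  have hcoprime : IsCoprime (3 * j + 1) (3 ^ n : ℤ) := IsCoprime.pow_right ⟨1, -j, by ring⟩
  have hden := Rat.den_div_eq_of_coprime (by positivity) (Int.isCoprime_iff_nat_coprime.1 hcoprime)
  exact_mod_cast hden

theorem exists_rat_den_eq_three_pow (x : ℝ) (n : ℕ) :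
    ∃ r : ℚ, r.den = 3 ^ (n + 1) ∧ |x - r| ≤ (1 / 3) ^ n := by
  refine ⟨_, den_three_mul_add_one_div ⌊3 ^ n * x⌋ (n + 1), ?_⟩
  have hdiff : x - (((3 * ⌊3 ^ n * x⌋ + 1 : ℤ) / (3 ^ (n + 1) : ℤ) : ℚ) : ℝ) =
      (3 ^ n * x - ⌊3 ^ n * x⌋ - 1 / 3) * (1 / 3) ^ n := by
    push_cast
    rw [pow_succ, one_div_pow]
    field_simp
    ring
  rw [hdiff, abs_mul, abs_of_pos (a := ((1 : ℝ) / 3) ^ n) (by positivity)]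
  refine mul_le_of_le_one_left (by positivity) (abs_le.2 ⟨?_, ?_⟩)
  · linarith [Int.floor_le (3 ^ n * x)]
  · linarith [Int.lt_floor_add_one (3 ^ n * x)]

theorem dense_setOf_odd_den_ge (N : ℕ) :
    Dense {x : ℝ | ∃ r : ℚ, Odd r.den ∧ N ≤ r.den ∧ r = x} := by
  intro x
  choose r hden hr using exists_rat_den_eq_three_pow x
  have hlim : Tendsto (fun n => (r n : ℝ)) atTop (𝓝 x) := by
    refine tendsto_iff_dist_tendsto_zero.2 (squeeze_zero (fun _ => dist_nonneg) (fun n => ?_)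
      (tendsto_pow_atTop_nhds_zero_of_lt_one (r := (1 / 3 : ℝ)) (by norm_num) (by norm_num)))
    rw [dist_comm]
    exact hr n
  refine mem_closure_of_tendsto hlim ((eventually_ge_atTop N).mono fun n hn => ?_)
  refine ⟨r n, ?_, ?_, rfl⟩
  · exact hden n ▸ Odd.pow (by decide)
  · exact hden n ▸ hn.trans (n.le_succ.trans (Nat.lt_pow_self (by norm_num)).le)

theorem eventually_residual_oddApproximable (k : ℕ) : ∀ᶠ α in residual ℝ, OddApproximable k α := by
  simp only [OddApproximable, (atTop_basis.comap Rat.den).frequently_iff, forall_const]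
  refine eventually_countable_forall.2 fun N => residual_of_dense_open ?_ ?_
  · have hunion : {α : ℝ | ∃ r ∈ Rat.den ⁻¹' Ici N, IsOddApprox k α r} =
        ⋃ r ∈ {r : ℚ | N ≤ r.den ∧ Odd r.den},
          {α : ℝ | r.den ^ (k + 2) * |α - r| < 1 / 4} := by
      ext α
      simp [IsOddApprox, and_assoc]
    rw [hunion]
    exact isOpen_biUnion fun r _ => isOpen_lt (by fun_prop) continuous_const
  · refine (dense_setOf_odd_den_ge N).mono ?_
    rintro _ ⟨r, hodd, hN, rfl⟩
    exact ⟨r, hN, hodd, by simp⟩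

theorem not_countable_inter_of_mem_residual {X : Type*} [TopologicalSpace X] [T1Space X]
    [BaireSpace X] [∀ x : X, (𝓝[≠] x).NeBot] {s U : Set X} (hs : s ∈ residual X) (hU : IsOpen U)
    (hne : U.Nonempty) : ¬(s ∩ U).Countable := by
  intro hcount
  have hcompl : (s ∩ U)ᶜ ∈ residual X := by
    rw [← biUnion_of_singleton (s ∩ U), compl_iUnion₂]
    exact (countable_bInter_mem hcount).2 fun x _ =>
      residual_of_dense_open isOpen_compl_singleton (dense_compl_singleton x)
  obtain ⟨x, hxU, hxs, hx⟩ :=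
    (dense_of_mem_residual (inter_mem hs hcompl)).inter_open_nonempty U hU hne
  exact hx ⟨hxs, hxU⟩

end Genericity

end Staircase

theorem mainTheorem5_general :
    ∀ᶠ α in residual ℝ, Irrational α ∧
      Ergodic (Staircase.infiniteStaircase α)
        ((volume : Measure UnitAddCircle).prod (Measure.count : Measure ℤ)) ∧
      Staircase.staircaseLyapunovExponent α = 1 := by
  filter_upwards
    [eventually_countable_forall.2 Staircase.eventually_residual_oddApproximable] with α h
  exact ⟨(h 1).irrational, (h 1).ergodic_infiniteStaircase,
    Staircase.staircaseLyapunovExponent_eq_one h⟩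

theorem mainTheorem5 (l : ℝ) (hl0 : 0 < l) (hl1 : l < 1 / 2) :
    ∃ A : Set ℝ, ¬ A.Countable ∧
      ∀ α ∈ A, α ∈ Set.Ioo (0 : ℝ) 1 ∧ Irrational α ∧
        Ergodic (Staircase.infiniteStaircase α)
          ((volume : Measure UnitAddCircle).prod (Measure.count : Measure ℤ)) ∧
        (l : EReal) ≤ Staircase.staircaseLyapunovExponent α ∧
        Staircase.staircaseLyapunovExponent α ≠ 0 := by
  refine ⟨_, Staircase.not_countable_inter_of_mem_residual mainTheorem5_general isOpen_Ioo
    (Set.nonempty_Ioo.2 one_pos), fun α ⟨⟨hirr, herg, hΛ⟩, hα⟩ => ⟨hα, hirr, herg, ?_, ?_⟩⟩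
  · rw [hΛ]
    exact_mod_cast hl1.le.trans (by norm_num)
  · simp [hΛ]
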